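/- Let $E$ and $F$ be complex Banach spaces, $U\subseteq E$ open, $v\colon U\to(0,\infty)$ continuous, and $p\in[1,\infty)$ with conjugate index $p^*$. Let $\mathcal H^\infty_v(U,F)$ be the space of all holomorphic mappings $f\colon U\to F$ with $\sup_{x\in U}v(x)\|f(x)\|<\infty$. For a complex Banach space $X$, let $\ell_p(X)$ be the space of sequences in $X$ with $\|(x_n)\|_p=(\sum_n\|x_n\|^p)^{1/p}<\infty$, let $\ell^w_p(X)$ be the space of sequences with $\|(x_n)\|^w_p=\sup_{x^*\in B_{X^*}}\|(x^*(x_n))\|_p<\infty$, and let $\ell^u_p(X)$ be the space of those $(x_n)\in\ell^w_p(X)$ with $\|(x_n)_{n\ge m}\|^w_p\to0$ as $m\to\infty$, normed by $\|\cdot\|_p^w$. Put $p\text{-}\mathrm{conv}(x_n)=\{\sum_n a_nx_n : (a_n)\in B_{\ell_{p^*}}\}$, with $B_{c_0}$ in place of $B_{\ell_{p^*}}$ if $p=1$. A set $K\subseteq X$ is relatively $p$-compact (respectively relatively weakly $p$-compact, relatively unconditionally $p$-compact) if $K\subseteq p\text{-}\mathrm{conv}(x_n)$ for some $(x_n)$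 in $\ell_p(X)$ (respectively $\ell_p^w(X)$, $\ell_p^u(X)$). The infimum of the norms of such $(x_n)$ is denoted by $m_{\mathcal I}(K)$, where $\mathcal I=\mathcal K_p$ (respectively $\mathcal K_{wp}$, $\mathcal K_{up}$). For Banach spaces $G$ and $X$, $\mathcal I(G,X)$ is the set of bounded linear operators $T\colon G\to X$ for which $T(B_G)$ has the corresponding compactness property, and $\|T\|_{\mathcal I}=m_{\mathcal I}(T(B_G))$. Likewise, $\mathcal H^\infty_{v\mathcal I}(U,X)$ is the set of $f\in\mathcal H^\infty_v(U,X)$ for which $(vf)(U)=\{v(x)f(x):x\in U\}$ has that property, and $\|f\|_{\mathcal H^\infty_{v\mathcal I}}=m_{\mathcal I}((vf)(U))$. Let $\mathcal I\in\{\mathcal K_p,\mathcal K_{wp},\mathcal K_{up}\}$, and put $\mathcal A=\mathcal K_{wp}$ if $\mathcal I=\mathcal K_p$ and $\mathcal A=\mathcal I$ otherwise. For every $f\in\mathcal H^\infty_v(U,F)$ the following are equivalent: 1. $f\in\mathcal H^\infty_{v\mathcal I}(U,F)$. 2. There exist a quotient space $G$ of $\ell_{p^*}$ (of $c_0$ if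 $p=1$) by a closed subspace, an operator $S\in\mathcal I(G,F)$ and a mapping $g\in\mathcal H^\infty_{v\mathcal A}(U,G)$ such that $f=S\circ g$. In this case $\|f\|_{\mathcal H^\infty_{v\mathcal I}}=\inf\{\|S\|_{\mathcal I}\,\|g\|_{\mathcal H^\infty_{v\mathcal A}}\}$, where the infimum is taken over all factorizations as in 2. -/

import Mathlib

open Set Filter Topology
open scoped ENNReal

/-! ### Sequence spaces -/

/-- The conjugate index `p*` of `p ∈ [1, ∞)`, given by `1/p + 1/p* = 1` (so `1* = ∞`). -/
noncomputable abbrev conjIndex (p : ℝ) : ℝ≥0∞ := ENNReal.conjExponent (ENNReal.ofReal p)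

instance conjIndex_fact (p : ℝ) : Fact (1 ≤ conjIndex p) :=
  ⟨by unfold conjIndex ENNReal.conjExponent; exact le_self_add⟩

/-- The subspace of `ℓ_{p*}` consisting of all sequences if `p ≠ 1`, and of the null sequences
if `p = 1`. -/
noncomputable def coeffSubmodule (p : ℝ) : Submodule ℂ (lp (fun _ : ℕ => ℂ) (conjIndex p)) where
  carrier := {a | p = 1 → Tendsto (fun n => a n) atTop (𝓝 0)}
  zero_mem' := fun _ => by simp
  add_mem' := fun {a b} ha hb hp => by simpa using (ha hp).add (hb hp)
  smul_mem' := fun c a ha hp => by simpa using (ha hp).const_smul c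

/-- The complex Banach space `ℓ_{p*}` if `p ≠ 1`, and `c₀` with the supremum norm (the norm of
`ℓ_∞ = ℓ_{1*}`) if `p = 1`. -/
def CoeffSpace (p : ℝ) : Type := coeffSubmodule p

namespace CoeffSpace

noncomputable instance (p : ℝ) : NormedAddCommGroup (CoeffSpace p) :=
  inferInstanceAs (NormedAddCommGroup (coeffSubmodule p))

noncomputable instance (p : ℝ) : NormedSpace ℂ (CoeffSpace p) :=
  inferInstanceAs (NormedSpace ℂ (coeffSubmodule p))

/-- The `n`-th term of a sequence. -/
def coord {p : ℝ} (a : CoeffSpace p) (n : ℕ) : ℂ := a.1 n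

end CoeffSpace

/-- `‖(x_n)‖_p`, with value `∞` if `(x_n)` is not `p`-summable. -/
noncomputable def seqNorm {X : Type*} [NormedAddCommGroup X] (p : ℝ) (x : ℕ → X) : ℝ≥0∞ :=
  (∑' n, ‖x n‖ₑ ^ p) ^ (1 / p)

/-- `‖(x_n)‖_p^w`, with value `∞` if `(x_n)` is not weakly `p`-summable. -/
noncomputable def weakSeqNorm {X : Type*} [NormedAddCommGroup X] [NormedSpace ℂ X]
    (p : ℝ) (x : ℕ → X) : ℝ≥0∞ :=
  ⨆ (φ : StrongDual ℂ X) (_ : ‖φ‖ ≤ 1), seqNorm p (fun n => φ (x n))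

/-- The `p`-convex hull of a sequence: the set of all `∑ a_n x_n` with `(a_n)` in the closed
unit ball of `ℓ_{p*}` (of `c₀` if `p = 1`). -/
def pConv {X : Type*} [NormedAddCommGroup X] [NormedSpace ℂ X] (p : ℝ) (x : ℕ → X) : Set X :=
  {y | ∃ a : CoeffSpace p, ‖a‖ ≤ 1 ∧ HasSum (fun n => a.coord n • x n) y}

/-! ### The three kinds of `p`-compactness -/

/-- Labels for the three operator ideals `𝒦_p`, `𝒦_{wp}` and `𝒦_{up}`. -/
inductive CompactKind where
  | strong
  | weak
  | unconditional

namespace CompactKind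

/-- The label of the ideal `𝒜` belonging to `ℐ`: `𝒜 = 𝒦_{wp}` if `ℐ = 𝒦_p`, and `𝒜 = ℐ`
otherwise. -/
def inner : CompactKind → CompactKind
  | strong => weak
  | weak => weak
  | unconditional => unconditional

variable {X : Type*} [NormedAddCommGroup X] [NormedSpace ℂ X]

/-- The sequence spaces `ℓ_p(X)`, `ℓ_p^w(X)` and `ℓ_p^u(X)`. -/
def seqSpace (I : CompactKind) (p : ℝ) : Set (ℕ → X) :=
  match I with
  | strong => {x | seqNorm p x < ∞}
  | weak => {x | weakSeqNorm p x < ∞}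
  | unconditional => {x | weakSeqNorm p x < ∞ ∧
      Tendsto (fun m => weakSeqNorm p (fun n => x (n + m))) atTop (𝓝 0)}

/-- The norms of the sequence spaces `ℓ_p(X)`, `ℓ_p^w(X)` and `ℓ_p^u(X)`. -/
noncomputable def norm (I : CompactKind) (p : ℝ) (x : ℕ → X) : ℝ≥0∞ :=
  match I with
  | strong => seqNorm p x
  | weak => weakSeqNorm p x
  | unconditional => weakSeqNorm p x

/-- `K` is relatively `p`-compact (weakly `p`-compact, unconditionally `p`-compact). -/
def RelCompact (I : CompactKind) (p : ℝ) (K : Set X) : Prop :=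
  ∃ x ∈ I.seqSpace p, K ⊆ pConv p x

/-- The measure `m_ℐ(K)`; it is finite if `K` is relatively compact of kind `I`, and `∞`
otherwise. -/
noncomputable def size (I : CompactKind) (p : ℝ) (K : Set X) : ℝ≥0∞ :=
  ⨅ (x : ℕ → X) (_ : x ∈ I.seqSpace p) (_ : K ⊆ pConv p x), I.norm p x

variable {Y : Type*} [NormedAddCommGroup Y] [NormedSpace ℂ Y]

/-- `T` belongs to the operator ideal `ℐ`. -/
def MemIdeal (I : CompactKind) (p : ℝ) (T : Y →L[ℂ] X) : Prop :=
  I.RelCompact p (T '' Metric.closedBall 0 1)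

/-- The ideal norm `‖T‖_ℐ`. -/
noncomputable def idealNorm (I : CompactKind) (p : ℝ) (T : Y →L[ℂ] X) : ℝ≥0∞ :=
  I.size p (T '' Metric.closedBall 0 1)

end CompactKind

/-! ### Weighted holomorphic mappings

Mappings on `U ⊆ E` are represented by functions on `E`, of which only the values on `U`
matter. -/

section Weighted

variable {E F : Type*} [NormedAddCommGroup E] [NormedSpace ℂ E]
  [NormedAddCommGroup F] [NormedSpace ℂ F]

/-- A weight on `U`: a strictly positive continuous function. -/
def IsWeight (U : Set E) (v : E → ℝ) : Prop :=
  ContinuousOn v U ∧ ∀ x ∈ U, 0 < v x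

/-- The space `ℋ_v^∞(U, F)`. -/
def weightedHol (U : Set E) (v : E → ℝ) : Set (E → F) :=
  {f | DifferentiableOn ℂ f U ∧ BddAbove ((fun x => v x * ‖f x‖) '' U)}

/-- The `v`-range `(vf)(U)`. -/
def vRange (U : Set E) (v : E → ℝ) (f : E → F) : Set F :=
  (fun x => (v x : ℂ) • f x) '' U

/-- The space `ℋ_{vℐ}^∞(U, F)`. -/
def weightedHolIdeal (I : CompactKind) (p : ℝ) (U : Set E) (v : E → ℝ) : Set (E → F) :=
  {f | f ∈ weightedHol U v ∧ I.RelCompact p (vRange U v f)}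

/-- The norm of `ℋ_{vℐ}^∞(U, F)`. -/
noncomputable def weightedHolIdealNorm (I : CompactKind) (p : ℝ) (U : Set E) (v : E → ℝ)
    (f : E → F) : ℝ≥0∞ :=
  I.size p (vRange U v f)

/-- `f = S ∘ g` on `U` with `S ∈ ℐ(G, F)` and `g ∈ ℋ_{v𝒜}^∞(U, G)`. -/
def IsFactorization {G : Type*} [NormedAddCommGroup G] [NormedSpace ℂ G]
    (I : CompactKind) (p : ℝ) (U : Set E) (v : E → ℝ) (f : E → F)
    (S : G →L[ℂ] F) (g : E → G) : Prop :=
  I.MemIdeal p S ∧ g ∈ weightedHolIdeal I.inner p U v ∧ ∀ x ∈ U, f x = S (g x)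

end Weighted

/-! For 2 ⇒ 1, note `(vf)(U) = S((vg)(U))`. By Hölder, a `p`-convex hull lies in the ball whose
radius is the weak norm of its sequence, so `S` maps `(vg)(U)` into a rescaled hull of the sequence
that covers `S(B_G)`. This also gives one half of the norm formula (`size_image_le`). For 1 ⇒ 2, let
`(vf)(U)` lie in the hull of `x`. Write `x_n = λ_n y_n` with `y` of kind `I`, almost the same norm,
`|λ_n| ≤ 1`, and `λ` null in the unconditional case (`exists_smul_factorization`). Let `θ a = ∑ a_n
y_n` on the coefficient space, `q` the quotient map by `ker θ`, and `S` the injective operator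
induced by `θ`. If `a(u)` are coefficients of `v(u) f(u)` with respect to `x`, put `g(u) = v(u)⁻¹
q((λ_n a_n(u))_n)`. Then `S ∘ g = f`, and `(vg)(U)` lies in the hull of `(λ_n q(e_n))`, whose weak
norm is at most 1 because the unit vectors `e_n` have weak `p`-norm at most 1. The choice of `a(u)`
is arbitrary, so holomorphy of `g` has to come from that of `S ∘ g`: it follows from injectivity of
`S`, local boundedness of `g` and separability of the quotient
(`differentiableOn_of_injective_comp`). -/

/-! ### Conjugate index and coefficient space -/

theorem conjIndex_one : conjIndex 1 = ∞ := by
  simp [conjIndex, ENNReal.conjExponent]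

theorem conjIndex_of_one_lt {p : ℝ} (hp : 1 < p) :
    conjIndex p = ENNReal.ofReal (p / (p - 1)) := by
  have h : (0 : ℝ) < p - 1 := by linarith
  rw [conjIndex, ENNReal.conjExponent, ← ENNReal.ofReal_one,
    ← ENNReal.ofReal_sub _ zero_le_one, ← ENNReal.ofReal_inv_of_pos h,
    ← ENNReal.ofReal_add zero_le_one (inv_nonneg.2 h.le)]
  congr 1
  field_simp
  ring

theorem conjIndex_toReal {p : ℝ} (hp : 1 < p) : (conjIndex p).toReal = p / (p - 1) := by
  rw [conjIndex_of_one_lt hp, ENNReal.toReal_ofReal]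
  have h : (0 : ℝ) < p - 1 := by linarith
  positivity

theorem conjIndex_toReal_pos {p : ℝ} (hp : 1 < p) : 0 < (conjIndex p).toReal := by
  rw [conjIndex_toReal hp]
  have h : (0 : ℝ) < p - 1 := by linarith
  positivity

theorem holderConjugate_conjIndex {p : ℝ} (hp : 1 < p) :
    p.HolderConjugate (conjIndex p).toReal := by
  rw [conjIndex_toReal hp]
  exact Real.HolderConjugate.conjExponent hp

theorem isClosed_coeffSubmodule (p : ℝ) :
    IsClosed (coeffSubmodule p : Set (lp (fun _ : ℕ => ℂ) (conjIndex p))) := by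
  refine isClosed_of_closure_subset fun a ha hp => ?_
  rw [Metric.tendsto_atTop]
  intro ε hε
  obtain ⟨b, hb, hab⟩ := Metric.mem_closure_iff.1 ha (ε / 2) (by positivity)
  obtain ⟨N, hN⟩ := Metric.tendsto_atTop.1 (hb hp) (ε / 2) (by positivity)
  refine ⟨N, fun n hn => ?_⟩
  have h1 := hN n hn
  have h2 : ‖a n - b n‖ ≤ ‖a - b‖ :=
    lp.norm_apply_le_norm (one_pos.trans_le Fact.out).ne' (a - b) n
  rw [dist_zero_right] at h1 ⊢
  rw [dist_eq_norm] at hab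
  calc ‖a n‖ = ‖(a n - b n) + b n‖ := by simp
    _ ≤ ‖a n - b n‖ + ‖b n‖ := norm_add_le _ _
    _ < ε := by linarith

namespace CoeffSpace

variable {p : ℝ}

instance : CompleteSpace (CoeffSpace p) :=
  (isClosed_coeffSubmodule p).completeSpace_coe

/-- The inclusion into `ℓ_{p*}`. -/
noncomputable def toLp (p : ℝ) : CoeffSpace p →ₗᵢ[ℂ] lp (fun _ : ℕ => ℂ) (conjIndex p) :=
  (coeffSubmodule p).subtypeₗᵢ

theorem toLp_apply (a : CoeffSpace p) (n : ℕ) : toLp p a n = a.coord n := rfl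

theorem norm_coord_le (a : CoeffSpace p) (n : ℕ) : ‖a.coord n‖ ≤ ‖a‖ :=
  lp.norm_apply_le_norm (one_pos.trans_le Fact.out).ne' (toLp p a) n

/-- The sequence with the single nonzero term `c` at the place `n`. -/
noncomputable def single (p : ℝ) (n : ℕ) (c : ℂ) : CoeffSpace p :=
  ⟨lp.single _ n c, fun _ => by
    refine tendsto_const_nhds.congr' ?_
    filter_upwards [eventually_gt_atTop n] with m hm
    simp [hm.ne']⟩

theorem toLp_single (n : ℕ) (c : ℂ) : toLp p (single p n c) = lp.single _ n c := rfl

theorem toLp_sum_single (s : Finset ℕ) (c : ℕ → ℂ) :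
    toLp p (∑ n ∈ s, single p n (c n)) = ∑ n ∈ s, lp.single _ n (c n) := by
  simp [toLp_single]

theorem single_eq_smul (n : ℕ) (c : ℂ) : single p n c = c • single p n 1 := by
  apply (toLp p).injective
  rw [map_smul, toLp_single, toLp_single, ← lp.single_smul, smul_eq_mul, mul_one]

theorem coord_sum_single (s : Finset ℕ) (c : ℕ → ℂ) (m : ℕ) :
    (∑ n ∈ s, single p n (c n)).coord m = if m ∈ s then c m else 0 := by
  rw [← toLp_apply, toLp_sum_single]
  simp only [lp.coeFn_sum, Finset.sum_apply, lp.coeFn_single, Finset.sum_pi_single]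

theorem norm_sum_single_le_of_forall_le (s : Finset ℕ) (c : ℕ → ℂ) {r : ℝ} (hr : 0 ≤ r)
    (h : ∀ n ∈ s, ‖c n‖ ≤ r) : ‖∑ n ∈ s, single 1 n (c n)‖ ≤ r := by
  rw [← (toLp 1).norm_map]
  -- `conjIndex 1` equals `∞` only propositionally, so the exponent is generalized before
  -- substituting.
  have key : ∀ q : ℝ≥0∞, q = ∞ → ∀ a : lp (fun _ : ℕ => ℂ) q, (∀ n, ‖a n‖ ≤ r) → ‖a‖ ≤ r := by
    rintro _ rfl a ha
    exact lp.norm_le_of_forall_le hr ha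
  refine key _ conjIndex_one _ fun n => ?_
  rw [toLp_apply, coord_sum_single]
  split_ifs with hn
  · exact h n hn
  · simpa using hr

theorem norm_sum_single_rpow (hp : 1 < p) (s : Finset ℕ) (c : ℕ → ℂ) :
    ‖∑ n ∈ s, single p n (c n)‖ ^ (conjIndex p).toReal
      = ∑ n ∈ s, ‖c n‖ ^ (conjIndex p).toReal := by
  rw [← (toLp p).norm_map, toLp_sum_single]
  exact lp.norm_sum_single (conjIndex_toReal_pos hp) c s

/-- Hölder's inequality for finite sums. -/
theorem norm_sum_mul_le (hp : 1 ≤ p) (a : CoeffSpace p) (b : ℕ → ℂ) (s : Finset ℕ) :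
    ‖∑ n ∈ s, a.coord n * b n‖ ≤ ‖a‖ * (∑ n ∈ s, ‖b n‖ ^ p) ^ (1 / p) := by
  have h0 : ‖∑ n ∈ s, a.coord n * b n‖ ≤ ∑ n ∈ s, ‖a.coord n‖ * ‖b n‖ :=
    (norm_sum_le _ _).trans_eq (by simp)
  refine h0.trans ?_
  rcases hp.eq_or_lt with rfl | hp
  · simp only [Real.rpow_one, div_one, Finset.mul_sum]
    gcongr
    exact norm_coord_le a _
  · have hq := conjIndex_toReal_pos hp
    have h1 := Real.inner_le_Lp_mul_Lq s (fun n => ‖a.coord n‖) (fun n => ‖b n‖)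
      (holderConjugate_conjIndex hp).symm
    simp only [abs_norm] at h1
    refine h1.trans ?_
    gcongr
    have h2 := lp.sum_rpow_le_norm_rpow hq (toLp p a) s
    rw [(toLp p).norm_map] at h2
    calc _ ≤ (‖a‖ ^ (conjIndex p).toReal) ^ (1 / (conjIndex p).toReal) := by
          gcongr
          exact h2
      _ = ‖a‖ := by rw [one_div, Real.rpow_rpow_inv (norm_nonneg _) hq.ne']

/-- The expansion fails in `ℓ_∞`; for `p = 1` it rests on the terms tending to zero, and for `p > 1`
on `p*` being finite. Separability and the convergence of `∑ a_n x_n` both depend on it. -/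
theorem hasSum_single (hp : 1 ≤ p) (a : CoeffSpace p) :
    HasSum (fun n => single p n (a.coord n)) a := by
  rcases hp.eq_or_lt with rfl | hp
  · rw [HasSum, SummationFilter.unconditional_filter, Metric.tendsto_atTop]
    intro ε hε
    obtain ⟨N, hN⟩ := Metric.tendsto_atTop.1 (a.2 rfl) (ε / 2) (by positivity)
    refine ⟨Finset.range N, fun s hs => ?_⟩
    rw [dist_eq_norm]
    refine lt_of_le_of_lt ?_ (half_lt_self hε)
    rw [← (toLp 1).norm_map]
    have key : ∀ q : ℝ≥0∞, q = ∞ → ∀ a : lp (fun _ : ℕ => ℂ) q,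
        (∀ n, ‖a n‖ ≤ ε / 2) → ‖a‖ ≤ ε / 2 := by
      rintro _ rfl a ha
      exact lp.norm_le_of_forall_le (by positivity) ha
    refine key _ conjIndex_one _ fun n => ?_
    rw [map_sub, lp.coeFn_sub, Pi.sub_apply, toLp_apply, toLp_apply, coord_sum_single]
    split_ifs with hn
    · simpa using (half_pos hε).le
    · have hn' : N ≤ n := by
        by_contra h
        exact hn (hs (Finset.mem_range.2 (not_le.1 h)))
      have := hN n hn'
      rw [dist_zero_right] at this
      rw [zero_sub, norm_neg]
      exact this.le
  · rw [← (toLp p).isometry.isEmbedding.isInducing.hasSum_iff (g := (toLp p).toLinearMap)]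
    refine lp.hasSum_single ?_ (toLp p a)
    rw [conjIndex_of_one_lt hp]
    exact ENNReal.ofReal_ne_top

/-- The unit vectors are weakly `p`-summable with norm at most one. -/
theorem sum_norm_apply_single_rpow_le (hp : 1 ≤ p) (φ : StrongDual ℂ (CoeffSpace p))
    (hφ : ‖φ‖ ≤ 1) (s : Finset ℕ) : ∑ n ∈ s, ‖φ (single p n 1)‖ ^ p ≤ 1 := by
  set b : ℕ → ℂ := fun n => φ (single p n 1) with hb
  choose u hu hub using fun n => RCLike.exists_norm_eq_mul_self (b n)
  -- The extremal coefficients in Hölder's inequality: `c_n b_n = |b_n|^p`, so `φ` takes the value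
  -- `T` at `∑ c_n e_n`.
  set c : ℕ → ℂ := fun n => ((‖b n‖ ^ (p - 1) : ℝ) : ℂ) * u n with hc
  have hcn : ∀ n, ‖c n‖ = ‖b n‖ ^ (p - 1) := fun n => by
    rw [hc]
    simp only [norm_mul, hu, mul_one, Complex.norm_real, Real.norm_eq_abs]
    exact abs_of_nonneg (by positivity)
  set T := ∑ n ∈ s, ‖b n‖ ^ p with hT
  set N := ‖∑ n ∈ s, single p n (c n)‖ with hN
  have hφc : φ (∑ n ∈ s, single p n (c n)) = (T : ℂ) := by
    rw [map_sum, hT, Complex.ofReal_sum]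
    refine Finset.sum_congr rfl fun n _ => ?_
    rw [single_eq_smul, map_smul, smul_eq_mul]
    change c n * b n = _
    have hp' : ‖b n‖ ^ p = ‖b n‖ ^ (p - 1) * ‖b n‖ := by
      rw [← Real.rpow_add_one' (norm_nonneg _) (by linarith)]
      congr 1
      ring
    rw [hp', hc, Complex.ofReal_mul]
    simp only [mul_assoc]
    congr 1
    exact (hub n).symm
  have hT0 : 0 ≤ T := by positivity
  have hTN : T ≤ N := by
    have h1 := φ.le_opNorm (∑ n ∈ s, single p n (c n))
    rw [hφc, Complex.norm_real, Real.norm_of_nonneg hT0] at h1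
    exact h1.trans (mul_le_of_le_one_left (norm_nonneg _) hφ)
  rcases hp.eq_or_lt with rfl | hp
  · refine hTN.trans (norm_sum_single_le_of_forall_le s c zero_le_one fun n _ => ?_)
    simp [hcn]
  -- Since `(p - 1) p* = p`, the norm satisfies `N ^ p* = T`. With `T ≤ N` and `p* > 1` this
  -- excludes `T > 1`.
  · have hNq : N ^ (conjIndex p).toReal = T := by
      rw [hN, norm_sum_single_rpow hp]
      refine Finset.sum_congr rfl fun n _ => ?_
      rw [hcn, ← Real.rpow_mul (norm_nonneg _), conjIndex_toReal hp]
      congr 1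
      field_simp [(sub_pos.2 hp).ne']
    by_contra! h
    have hq := (holderConjugate_conjIndex hp).symm.lt
    have h2 : N ^ (1 : ℝ) < N ^ (conjIndex p).toReal :=
      Real.rpow_lt_rpow_of_exponent_lt (h.trans_le hTN) hq
    rw [hNq, Real.rpow_one] at h2
    exact absurd hTN (not_le.2 h2)

theorem separableSpace (hp : 1 ≤ p) : TopologicalSpace.SeparableSpace (CoeffSpace p) := by
  have h1 : TopologicalSpace.IsSeparable
      (Submodule.span ℂ (range fun n => single p n 1) : Set (CoeffSpace p)) :=
    (countable_range _).isSeparable.span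
  rw [← TopologicalSpace.isSeparable_univ_iff]
  refine h1.closure.mono fun a _ => ?_
  refine mem_closure_of_tendsto (hasSum_single hp a) (Eventually.of_forall fun s => ?_)
  refine Submodule.sum_mem _ fun n _ => ?_
  rw [single_eq_smul]
  exact Submodule.smul_mem _ _ (Submodule.subset_span ⟨n, rfl⟩)

end CoeffSpace

/-! ### Strong, weak and unconditional summability -/

section SequenceNorms

theorem seqNorm_le_iff {X : Type*} [NormedAddCommGroup X] {p : ℝ} (hp : 0 < p) {x : ℕ → X} {c : ℝ≥0∞} :
    seqNorm p x ≤ c ↔ ∑' n, ‖x n‖ₑ ^ p ≤ c ^ p := by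
  rw [seqNorm, one_div, ENNReal.rpow_inv_le_iff hp]

variable {X Y : Type*} [NormedAddCommGroup X] [NormedSpace ℂ X]
  [NormedAddCommGroup Y] [NormedSpace ℂ Y] {p : ℝ}

theorem weakSeqNorm_le_iff {x : ℕ → X} {c : ℝ≥0∞} :
    weakSeqNorm p x ≤ c ↔ ∀ φ : StrongDual ℂ X, ‖φ‖ ≤ 1 → seqNorm p (fun n => φ (x n)) ≤ c :=
  iSup₂_le_iff

theorem seqNorm_apply_le_weakSeqNorm (x : ℕ → X) {φ : StrongDual ℂ X} (hφ : ‖φ‖ ≤ 1) :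
    seqNorm p (fun n => φ (x n)) ≤ weakSeqNorm p x :=
  weakSeqNorm_le_iff.1 le_rfl φ hφ

theorem weakSeqNorm_le_seqNorm (hp : 0 < p) (x : ℕ → X) : weakSeqNorm p x ≤ seqNorm p x := by
  refine weakSeqNorm_le_iff.2 fun φ hφ => (seqNorm_le_iff hp).2 ?_
  refine le_trans ?_ ((seqNorm_le_iff hp).1 le_rfl)
  refine ENNReal.tsum_le_tsum fun n => ENNReal.rpow_le_rpow ?_ hp.le
  rw [enorm_le_iff_norm_le]
  exact (φ.le_opNorm _).trans (mul_le_of_le_one_left (norm_nonneg _) hφ)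

theorem weakSeqNorm_comp_le (x : ℕ → X) {T : X →L[ℂ] Y} (hT : ‖T‖ ≤ 1) :
    weakSeqNorm p (fun n => T (x n)) ≤ weakSeqNorm p x := by
  refine weakSeqNorm_le_iff.2 fun φ hφ => ?_
  refine seqNorm_apply_le_weakSeqNorm (φ := φ.comp T) x ?_
  exact (φ.opNorm_comp_le T).trans (mul_le_one₀ hφ (norm_nonneg _) hT)

theorem seqNorm_smul_le (hp : 0 < p) {lam : ℕ → ℂ} {c : ℝ≥0∞} (h : ∀ n, ‖lam n‖ₑ ≤ c)
    (x : ℕ → X) : seqNorm p (fun n => lam n • x n) ≤ c * seqNorm p x := by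
  rw [seqNorm_le_iff hp, ENNReal.mul_rpow_of_nonneg _ _ hp.le]
  refine le_trans ?_ (mul_le_mul_right ((seqNorm_le_iff hp).1 le_rfl) _)
  rw [← ENNReal.tsum_mul_left]
  refine ENNReal.tsum_le_tsum fun n => ?_
  rw [← ENNReal.mul_rpow_of_nonneg _ _ hp.le, enorm_smul]
  exact ENNReal.rpow_le_rpow (by gcongr; exact h n) hp.le

theorem weakSeqNorm_smul_le (hp : 0 < p) {lam : ℕ → ℂ} {c : ℝ≥0∞} (h : ∀ n, ‖lam n‖ₑ ≤ c)
    (x : ℕ → X) : weakSeqNorm p (fun n => lam n • x n) ≤ c * weakSeqNorm p x := by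
  refine weakSeqNorm_le_iff.2 fun φ hφ => ?_
  simp only [map_smul]
  refine (seqNorm_smul_le hp h _).trans ?_
  gcongr
  exact seqNorm_apply_le_weakSeqNorm x hφ

theorem weakSeqNorm_shift_le (hp : 0 < p) (x : ℕ → X) (m : ℕ) :
    weakSeqNorm p (fun n => x (n + m)) ≤ weakSeqNorm p x := by
  refine weakSeqNorm_le_iff.2 fun φ hφ => (seqNorm_le_iff hp).2 ?_
  refine le_trans ?_ ((seqNorm_le_iff hp).1 (seqNorm_apply_le_weakSeqNorm x hφ))
  exact ENNReal.tsum_comp_le_tsum_of_injective (add_left_injective m)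
    (fun n => ‖φ (x n)‖ₑ ^ p)

/-- Multiplication by a null sequence makes a weakly `p`-summable sequence unconditionally
`p`-summable. -/
theorem tendsto_weakSeqNorm_smul (hp : 0 < p) {lam : ℕ → ℂ} (h : Tendsto lam atTop (𝓝 0))
    {x : ℕ → X} (hx : weakSeqNorm p x < ∞) :
    Tendsto (fun m => weakSeqNorm p (fun n => lam (n + m) • x (n + m))) atTop (𝓝 0) := by
  rw [ENNReal.tendsto_atTop_zero]
  intro ε hε
  obtain ⟨δ, hδ, hδε⟩ := ENNReal.exists_pos_mul_lt hx.ne hε.ne'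
  obtain ⟨N, hN⟩ := ENNReal.tendsto_atTop_zero.1 (by simpa using h.enorm) δ hδ
  refine ⟨N, fun m hm => ?_⟩
  refine (weakSeqNorm_smul_le hp (c := δ) (fun n => hN _ (by omega)) _).trans ?_
  refine le_trans ?_ hδε.le
  gcongr
  exact weakSeqNorm_shift_le hp x m

/-- An unconditionally `p`-summable sequence remains weakly `p`-summable, with almost the same
norm, after division by some null sequence. -/
theorem exists_tendsto_zero_weakSeqNorm_inv_smul_le (hp : 1 ≤ p) {x : ℕ → X}
    (hx : weakSeqNorm p x < ∞)
    (hx0 : Tendsto (fun m => weakSeqNorm p (fun n => x (n + m))) atTop (𝓝 0))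
    {ε : ℝ≥0∞} (hε : ε ≠ 0) :
    ∃ lam : ℕ → ℝ, (∀ n, 0 < lam n) ∧ (∀ n, lam n ≤ 1) ∧ Tendsto lam atTop (𝓝 0) ∧
      weakSeqNorm p (fun n => (((lam n)⁻¹ : ℝ) : ℂ) • x n) ≤ weakSeqNorm p x + ε := by
  have hp0 : 0 < p := one_pos.trans_le hp
  set W := weakSeqNorm p x with hW
  have hlt : W ^ p < (W + ε) ^ p :=
    ENNReal.rpow_lt_rpow (ENNReal.lt_add_right hx.ne hε) hp0
  -- The `δ k` share out the room between `W ^ p` and `(W + ε) ^ p`; below, `m k` is a place past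
  -- which the tail of `x` costs at most `δ k`, uniformly in the functional.
  obtain ⟨δ, hδ, hδsum⟩ := ENNReal.exists_pos_sum_of_countable' (tsub_pos_of_lt hlt).ne' ℕ
  have htail : Tendsto (fun m => weakSeqNorm p (fun n => x (n + m)) ^ p) atTop (𝓝 0) := by
    have := (ENNReal.continuous_rpow_const (y := p)).tendsto 0 |>.comp hx0
    rwa [ENNReal.zero_rpow_of_pos hp0] at this
  have hex : ∀ k, ∃ m, weakSeqNorm p (fun n => x (n + m)) ^ p ≤ δ k := fun k => by
    obtain ⟨N, hN⟩ := ENNReal.tendsto_atTop_zero.1 htail (δ k) (hδ k)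
    exact ⟨N, hN N le_rfl⟩
  choose m hm using hex
  -- `μ n` counts tails that contain the index `n`; the bound `k ≤ n` keeps the count finite. With
  -- weights `lam n = (1 + μ n)^(-1/p)`, dividing by `lam` multiplies `|φ(x_n)|^p` by `1 + μ n`, and
  -- the surplus `∑ μ n |φ(x_n)|^p` is at most the sum of all tails, hence at most `∑ δ k`.
  set μ : ℕ → ℕ := fun n => ((Finset.range (n + 1)).filter fun k => m k ≤ n).card with hμ
  have hμtop : Tendsto μ atTop atTop := by
    refine tendsto_atTop_atTop.2 fun b => ⟨b + ∑ k ∈ Finset.range b, m k, fun n hn => ?_⟩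
    rw [← Finset.card_range b]
    refine Finset.card_le_card fun k hk => ?_
    have h1 := Finset.single_le_sum (f := m) (fun _ _ => Nat.zero_le _) hk
    rw [Finset.mem_range] at hk
    rw [Finset.mem_filter, Finset.mem_range]
    omega
  have hpos : ∀ n, (0 : ℝ) < 1 + μ n := fun n => by positivity
  refine ⟨fun n => (1 + μ n : ℝ) ^ (-(1 / p)), fun n => Real.rpow_pos_of_pos (hpos n) _,
    fun n => Real.rpow_le_one_of_one_le_of_nonpos (by simp) (by simp; positivity), ?_, ?_⟩
  · refine (tendsto_rpow_neg_atTop (y := 1 / p) (by positivity)).comp ?_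
    exact tendsto_atTop_add_const_left _ _ (tendsto_natCast_atTop_atTop.comp hμtop)
  · refine weakSeqNorm_le_iff.2 fun φ hφ => (seqNorm_le_iff hp0).2 ?_
    set b : ℕ → ℝ≥0∞ := fun n => ‖φ (x n)‖ₑ ^ p with hb
    have hterm : ∀ n, ‖φ ((((((1 + μ n : ℝ) ^ (-(1 / p)))⁻¹ : ℝ) : ℂ)) • x n)‖ₑ ^ p
        = b n + μ n * b n := fun n => by
      rw [map_smul, enorm_smul, ENNReal.mul_rpow_of_nonneg _ _ hp0.le]
      have : ‖((((1 + μ n : ℝ) ^ (-(1 / p)))⁻¹ : ℝ) : ℂ)‖ₑ ^ p = 1 + μ n := by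
        rw [← ofReal_norm, Complex.norm_real, Real.norm_of_nonneg
          (inv_nonneg.2 (Real.rpow_nonneg (hpos n).le _)), Real.rpow_neg (hpos n).le, inv_inv,
          ENNReal.ofReal_rpow_of_nonneg (Real.rpow_nonneg (hpos n).le _) hp0.le, one_div,
          Real.rpow_inv_rpow (hpos n).le hp0.ne', ENNReal.ofReal_add zero_le_one (by positivity)]
        simp
      rw [this, add_mul, one_mul]
    have hμle : ∀ n, (μ n : ℝ≥0∞) * b n ≤ ∑' k, if m k ≤ n then b n else 0 := fun n => by
      refine le_trans (le_of_eq ?_) (ENNReal.sum_le_tsum (Finset.range (n + 1)))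
      rw [← Finset.sum_filter, Finset.sum_const, nsmul_eq_mul]
    have hshift : ∀ k, (∑' n, if m k ≤ n then b n else 0) ≤ δ k := fun k => by
      rw [← Summable.sum_add_tsum_nat_add' (k := m k) ENNReal.summable]
      rw [Finset.sum_eq_zero fun n hn => if_neg (not_le.2 (Finset.mem_range.1 hn)), zero_add]
      simp only [le_add_iff_nonneg_left, zero_le, if_true]
      exact ((seqNorm_le_iff hp0).1
        (seqNorm_apply_le_weakSeqNorm (fun n => x (n + m k)) hφ)).trans (hm k)
    calc _ = ∑' n, (b n + μ n * b n) := tsum_congr hterm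
      _ = ∑' n, b n + ∑' n, μ n * b n := ENNReal.tsum_add
      _ ≤ W ^ p + ∑' n, ∑' k, (if m k ≤ n then b n else 0) :=
          add_le_add ((seqNorm_le_iff hp0).1 (seqNorm_apply_le_weakSeqNorm x hφ))
            (ENNReal.tsum_le_tsum hμle)
      _ = W ^ p + ∑' k, ∑' n, (if m k ≤ n then b n else 0) := by rw [ENNReal.tsum_comm]
      _ ≤ W ^ p + ∑' k, δ k := by
          gcongr with k
          exact hshift k
      _ ≤ W ^ p + ((W + ε) ^ p - W ^ p) := by gcongr
      _ = (W + ε) ^ p := add_tsub_cancel_of_le hlt.le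

end SequenceNorms

/-! ### Splitting off scalar factors -/

namespace CompactKind

variable {X : Type*} [NormedAddCommGroup X] [NormedSpace ℂ X] {p : ℝ} {I : CompactKind}

theorem weakSeqNorm_le_norm (hp : 0 < p) (x : ℕ → X) : weakSeqNorm p x ≤ I.norm p x := by
  cases I
  · exact weakSeqNorm_le_seqNorm hp x
  · exact le_rfl
  · exact le_rfl

theorem norm_lt_top {x : ℕ → X} (hx : x ∈ I.seqSpace p) : I.norm p x < ∞ := by
  cases I
  · exact hx
  · exact hx
  · exact hx.1

theorem norm_const_smul_le (hp : 0 < p) (c : ℂ) (x : ℕ → X) :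
    I.norm p (fun n => c • x n) ≤ ‖c‖ₑ * I.norm p x := by
  cases I
  · exact seqNorm_smul_le hp (fun _ => le_rfl) x
  · exact weakSeqNorm_smul_le hp (fun _ => le_rfl) x
  · exact weakSeqNorm_smul_le hp (fun _ => le_rfl) x

theorem const_smul_mem_seqSpace (hp : 0 < p) (c : ℂ) {x : ℕ → X} (hx : x ∈ I.seqSpace p) :
    (fun n => c • x n) ∈ I.seqSpace p := by
  have h : I.norm p (fun n => c • x n) < ∞ :=
    (norm_const_smul_le hp c x).trans_lt (ENNReal.mul_lt_top enorm_lt_top (norm_lt_top hx))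
  cases I
  · exact h
  · exact h
  · refine ⟨h, tendsto_of_tendsto_of_tendsto_of_le_of_le tendsto_const_nhds
      (g := fun _ => 0) (h := fun m => ‖c‖ₑ * weakSeqNorm p (fun n => x (n + m))) ?_
      (fun _ => zero_le) fun m => weakSeqNorm_smul_le hp (fun _ => le_rfl) _⟩
    simpa using ENNReal.Tendsto.const_mul hx.2 (Or.inr enorm_ne_top)

/-- Every sequence of kind `I` is, with almost the same norm, the product of a sequence of kind
`I` and a scalar sequence which multiplies weakly `p`-summable sequences into sequences of kind
`I.inner`. -/
theorem exists_smul_factorization (hp : 1 ≤ p) {x : ℕ → X} (hx : x ∈ I.seqSpace p)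
    {ε : ℝ≥0∞} (hε : ε ≠ 0) (hε' : ε < ∞) :
    ∃ (lam : ℕ → ℂ) (y : ℕ → X), y ∈ I.seqSpace p ∧ I.norm p y ≤ I.norm p x + ε ∧
      (∀ n, x n = lam n • y n) ∧ (∀ n, ‖lam n‖ₑ ≤ 1) ∧
      (I = unconditional → Tendsto lam atTop (𝓝 0)) := by
  by_cases hI : I = unconditional
  · subst hI
    have hp0 : 0 < p := one_pos.trans_le hp
    -- The null sequence is split as `√lam · √lam`: one factor is the multiplier, while the other
    -- keeps `y = √lam • (lam⁻¹ • x)` unconditionally summable.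
    obtain ⟨lam, hpos, hle, hlim, hnorm⟩ :=
      exists_tendsto_zero_weakSeqNorm_inv_smul_le hp hx.1 hx.2 hε
    have hs : ∀ n, ‖((√(lam n) : ℝ) : ℂ)‖ₑ ≤ 1 := fun n => by
      rw [← ofReal_norm, ENNReal.ofReal_le_one, Complex.norm_real,
        Real.norm_of_nonneg (Real.sqrt_nonneg _)]
      exact Real.sqrt_le_one.2 (hle n)
    have hs0 : Tendsto (fun n => ((√(lam n) : ℝ) : ℂ)) atTop (𝓝 0) := by
      have h1 : Tendsto (fun n => √(lam n)) atTop (𝓝 0) := by simpa using hlim.sqrt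
      exact_mod_cast (Complex.continuous_ofReal.tendsto 0).comp h1
    have hmul : ∀ n, ((√(lam n) : ℝ) : ℂ) * ((√(lam n) : ℝ) : ℂ) * (((lam n)⁻¹ : ℝ) : ℂ) = 1 :=
      fun n => by
        rw [← Complex.ofReal_mul, Real.mul_self_sqrt (hpos n).le, ← Complex.ofReal_mul,
          mul_inv_cancel₀ (hpos n).ne', Complex.ofReal_one]
    generalize hσ : (fun n => ((√(lam n) : ℝ) : ℂ)) = σ at hs0
    generalize hz : (fun n => (((lam n)⁻¹ : ℝ) : ℂ) • x n) = z at hnorm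
    have hs' : ∀ n, ‖σ n‖ₑ ≤ 1 := fun n => hσ ▸ hs n
    have hzt : weakSeqNorm p z < ∞ := hnorm.trans_lt (ENNReal.add_lt_top.2 ⟨hx.1, hε'⟩)
    have hy := (weakSeqNorm_smul_le hp0 hs' z).trans_eq (one_mul _)
    refine ⟨σ, fun n => σ n • z n,
      ⟨hy.trans_lt hzt, tendsto_weakSeqNorm_smul hp0 hs0 hzt⟩, hy.trans hnorm,
      fun n => ?_, hs', fun _ => hs0⟩
    rw [← hz, ← hσ]
    simp only [smul_smul, ← mul_assoc]
    rw [hmul, one_smul]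
  · exact ⟨fun _ => 1, x, hx, le_self_add, fun n => (one_smul _ _).symm, fun _ => by simp,
      fun h => absurd h hI⟩

/-- Applied to the images of the unit vectors, which are in general only weakly `p`-summable; this
is why `𝒜` is weak for the strong kind, and why the unconditional kind needs a null multiplier. -/
theorem smul_mem_seqSpace_inner (hp : 1 ≤ p) {lam : ℕ → ℂ} (h1 : ∀ n, ‖lam n‖ₑ ≤ 1)
    (h0 : I = unconditional → Tendsto lam atTop (𝓝 0)) {z : ℕ → X} (hz : weakSeqNorm p z ≤ 1) :
    (fun n => lam n • z n) ∈ I.inner.seqSpace p ∧ I.inner.norm p (fun n => lam n • z n) ≤ 1 := by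
  have hp0 : 0 < p := one_pos.trans_le hp
  have h : weakSeqNorm p (fun n => lam n • z n) ≤ 1 :=
    (weakSeqNorm_smul_le hp0 h1 z).trans (by simpa using hz)
  have ht := h.trans_lt ENNReal.one_lt_top
  cases I
  · exact ⟨ht, h⟩
  · exact ⟨ht, h⟩
  · exact ⟨⟨ht, tendsto_weakSeqNorm_smul hp0 (h0 rfl) (hz.trans_lt ENNReal.one_lt_top)⟩, h⟩

end CompactKind

/-! ### Synthesis operators of weakly summable sequences -/

section Synthesis

variable {X : Type*} [NormedAddCommGroup X] [NormedSpace ℂ X] {p : ℝ}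

theorem weakSeqNorm_single_le (hp : 1 ≤ p) :
    weakSeqNorm p (fun n => CoeffSpace.single p n 1) ≤ 1 := by
  refine weakSeqNorm_le_iff.2 fun φ hφ => (seqNorm_le_iff (one_pos.trans_le hp)).2 ?_
  rw [ENNReal.one_rpow, ENNReal.tsum_eq_iSup_sum]
  refine iSup_le fun s => ?_
  have h := CoeffSpace.sum_norm_apply_single_rpow_le hp φ hφ s
  rw [← ENNReal.ofReal_le_one, ENNReal.ofReal_sum_of_nonneg (fun _ _ => by positivity)] at h
  refine le_trans (le_of_eq (Finset.sum_congr rfl fun n _ => ?_)) h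
  rw [← ofReal_norm, ENNReal.ofReal_rpow_of_nonneg (norm_nonneg _) (by linarith)]

/-- A functional that norms the sum reduces the claim to the scalar Hölder inequality. -/
theorem norm_sum_smul_le (hp : 1 ≤ p) {x : ℕ → X} (hx : weakSeqNorm p x < ∞)
    (a : CoeffSpace p) (s : Finset ℕ) :
    ‖∑ n ∈ s, a.coord n • x n‖ ≤ ‖a‖ * (weakSeqNorm p x).toReal := by
  have hp0 : 0 < p := one_pos.trans_le hp
  obtain ⟨φ, hφ, hφx⟩ := exists_dual_vector'' ℂ (∑ n ∈ s, a.coord n • x n)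
  have h1 : ‖∑ n ∈ s, a.coord n • x n‖ = ‖∑ n ∈ s, a.coord n * φ (x n)‖ := by
    have h2 : φ (∑ n ∈ s, a.coord n • x n) = ∑ n ∈ s, a.coord n * φ (x n) := by simp
    rw [← h2, hφx]
    simp
  rw [h1]
  refine (CoeffSpace.norm_sum_mul_le hp a (fun n => φ (x n)) s).trans ?_
  gcongr
  have hnn : 0 ≤ ∑ n ∈ s, ‖φ (x n)‖ ^ p := by positivity
  rw [← ENNReal.ofReal_le_iff_le_toReal hx.ne, one_div,
    ← ENNReal.ofReal_rpow_of_nonneg hnn (inv_nonneg.2 hp0.le), ENNReal.rpow_inv_le_iff hp0,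
    ENNReal.ofReal_sum_of_nonneg (fun _ _ => by positivity)]
  refine le_trans ?_ ((seqNorm_le_iff hp0).1 (seqNorm_apply_le_weakSeqNorm x hφ))
  refine le_trans (le_of_eq (Finset.sum_congr rfl fun n _ => ?_)) (ENNReal.sum_le_tsum s)
  rw [← ofReal_norm, ENNReal.ofReal_rpow_of_nonneg (norm_nonneg _) hp0.le]

theorem norm_le_of_mem_pConv (hp : 1 ≤ p) {x : ℕ → X} (hx : weakSeqNorm p x < ∞) {y : X}
    (hy : y ∈ pConv p x) : ‖y‖ ≤ (weakSeqNorm p x).toReal := by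
  obtain ⟨a, ha, hay⟩ := hy
  refine le_of_tendsto hay.norm (Eventually.of_forall fun s => ?_)
  exact (norm_sum_smul_le hp hx a s).trans (mul_le_of_le_one_left ENNReal.toReal_nonneg ha)

theorem smul_mem_pConv (c : ℂ) {x : ℕ → X} {y : X} (hy : y ∈ pConv p x) :
    c • y ∈ pConv p (fun n => c • x n) := by
  obtain ⟨a, ha, hay⟩ := hy
  refine ⟨a, ha, ?_⟩
  simpa only [smul_comm c] using hay.const_smul c

theorem summable_coord_smul [CompleteSpace X] (hp : 1 ≤ p) {x : ℕ → X}
    (hx : weakSeqNorm p x < ∞) (a : CoeffSpace p) : Summable fun n => a.coord n • x n := by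
  rw [summable_iff_vanishing_norm]
  intro ε hε
  set W := (weakSeqNorm p x).toReal with hW
  have hW0 : 0 ≤ W := ENNReal.toReal_nonneg
  obtain ⟨s, hs⟩ := summable_iff_vanishing_norm.1 (CoeffSpace.hasSum_single hp a).summable
    (ε / (W + 1)) (by positivity)
  refine ⟨s, fun t ht => ?_⟩
  -- The bound is applied to the truncation of `a` to `t`, whose norm is small because the unit
  -- vector expansion of `a` is Cauchy.
  have h1 := norm_sum_smul_le hp hx (∑ n ∈ t, CoeffSpace.single p n (a.coord n)) t
  have h2 : ∑ n ∈ t, (∑ n ∈ t, CoeffSpace.single p n (a.coord n)).coord n • x n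
      = ∑ n ∈ t, a.coord n • x n := Finset.sum_congr rfl fun n hn => by
    rw [CoeffSpace.coord_sum_single, if_pos hn]
  rw [h2] at h1
  refine h1.trans_lt ?_
  have h3 := (lt_div_iff₀ (by positivity)).1 (hs t ht)
  have h4 := norm_nonneg (∑ n ∈ t, CoeffSpace.single p n (a.coord n))
  linarith

/-- The operator `(a_n) ↦ ∑ a_n x_n` on `ℓ_{p*}` (on `c₀` if `p = 1`) given by a weakly
`p`-summable sequence. -/
noncomputable def synthesis [CompleteSpace X] (hp : 1 ≤ p) {x : ℕ → X}
    (hx : weakSeqNorm p x < ∞) : CoeffSpace p →L[ℂ] X :=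
  LinearMap.mkContinuous
    { toFun := fun a => ∑' n, a.coord n • x n
      map_add' := fun a b => by
        rw [← (summable_coord_smul hp hx a).tsum_add (summable_coord_smul hp hx b)]
        simp only [← add_smul]
        rfl
      map_smul' := fun c a => by
        rw [RingHom.id_apply, ← (summable_coord_smul hp hx a).tsum_const_smul c]
        simp only [smul_smul]
        rfl }
    (weakSeqNorm p x).toReal fun a => by
      refine le_of_tendsto (summable_coord_smul hp hx a).hasSum.norm
        (Eventually.of_forall fun s => ?_)
      rw [mul_comm]
      exact norm_sum_smul_le hp hx a s

theorem hasSum_synthesis [CompleteSpace X] (hp : 1 ≤ p) {x : ℕ → X}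
    (hx : weakSeqNorm p x < ∞) (a : CoeffSpace p) :
    HasSum (fun n => a.coord n • x n) (synthesis hp hx a) :=
  (summable_coord_smul hp hx a).hasSum

theorem synthesis_single [CompleteSpace X] (hp : 1 ≤ p) {x : ℕ → X}
    (hx : weakSeqNorm p x < ∞) (n : ℕ) : synthesis hp hx (CoeffSpace.single p n 1) = x n := by
  have h : ∀ m, (CoeffSpace.single p n 1).coord m = if m = n then 1 else 0 := fun m => by
    have := CoeffSpace.coord_sum_single (p := p) {n} (fun _ => 1) m
    simpa using this
  refine (hasSum_synthesis hp hx _).unique ?_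
  convert! hasSum_ite_eq n (x n) using 2 with m
  rw [h]
  split_ifs with hm
  · rw [hm, one_smul]
  · rw [zero_smul]

theorem synthesis_mem_pConv [CompleteSpace X] (hp : 1 ≤ p) {x : ℕ → X}
    (hx : weakSeqNorm p x < ∞) {c : ℝ} (hc : 0 < c) {a : CoeffSpace p} (ha : ‖a‖ ≤ c) :
    synthesis hp hx a ∈ pConv p (fun n => (c : ℂ) • x n) := by
  have hc' : (c : ℂ) ≠ 0 := by exact_mod_cast hc.ne'
  rw [← smul_inv_smul₀ hc' (synthesis hp hx a), ← map_smul]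
  refine smul_mem_pConv _ ⟨_, ?_, hasSum_synthesis hp hx _⟩
  rw [norm_smul, norm_inv, Complex.norm_real, Real.norm_of_nonneg hc.le]
  exact (inv_mul_le_one₀ hc).2 ha

end Synthesis

/-! ### Holomorphy through an injective operator -/

section Holomorphy

variable {F G : Type*} [NormedAddCommGroup F] [NormedSpace ℂ F]
  [NormedAddCommGroup G] [NormedSpace ℂ G]

/-- A bounded function of one variable with values in a separable Banach space is holomorphic
if its composition with an injective operator is. -/
theorem differentiableOn_ball_of_injective_comp [CompleteSpace G] [TopologicalSpace.SeparableSpace G]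
    [CompleteSpace F] (S : G →L[ℂ] F) (hS : Function.Injective S) {g : ℂ → G} {R C : ℝ}
    (hg : ∀ z ∈ Metric.ball (0 : ℂ) R, ‖g z‖ ≤ C)
    (hSg : DifferentiableOn ℂ (fun z => S (g z)) (Metric.ball 0 R)) :
    DifferentiableOn ℂ g (Metric.ball 0 R) := by
  intro w hw
  rw [mem_ball_zero_iff] at hw
  obtain ⟨r, hwr, hrR⟩ := exists_between hw
  have hr : 0 < r := (norm_nonneg w).trans_lt hwr
  lift r to NNReal using hr.le
  have hsub : Metric.closedBall (0 : ℂ) r ⊆ Metric.ball 0 R :=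
    Metric.closedBall_subset_ball hrR
  have hmem : ∀ θ : ℝ, circleMap 0 r θ ∈ Metric.ball (0 : ℂ) R := fun θ =>
    hsub (circleMap_mem_closedBall 0 r.coe_nonneg θ)
  borelize F
  borelize G
  have : SecondCountableTopology G := UniformSpace.secondCountable_of_separable G
  -- Lusin–Souslin: an injective continuous map on a Polish space is a Borel embedding, so
  -- measurability of `S ∘ g` on the circle passes to `g`, and the Cauchy integral of `g` makes
  -- sense.
  have hemb : MeasurableEmbedding S := S.continuous.measurableEmbedding hS
  have hmeas : Measurable fun θ : ℝ => g (circleMap 0 r θ) := by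
    rw [← hemb.measurable_comp_iff]
    refine Continuous.measurable ?_
    exact hSg.continuousOn.comp_continuous (continuous_circleMap 0 r) hmem
  have hint : CircleIntegrable g 0 r := by
    rw [CircleIntegrable, intervalIntegrable_iff]
    refine MeasureTheory.Measure.integrableOn_of_bounded (M := C) ?_
      hmeas.aestronglyMeasurable (Eventually.of_forall fun θ => hg _ (hmem θ))
    rw [uIoc_of_le (by positivity), Real.volume_Ioc]
    exact ENNReal.ofReal_ne_top
  have hps := hasFPowerSeriesOn_cauchy_integral hint (by exact_mod_cast hr)
  set h : ℂ → G := fun w => (2 * Real.pi * Complex.I : ℂ)⁻¹ • ∮ z in C(0, r), (z - w)⁻¹ • g z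
    with hh
  -- Cauchy's formula for `S ∘ g` shows that `g` and its own Cauchy integral have the same image
  -- under `S`.
  have hgh : ∀ z ∈ Metric.ball (0 : ℂ) r, g z = h z := fun z hz => by
    apply hS
    have hci := (hSg.mono hsub).circleIntegral_sub_inv_smul hz
    have hne : ∀ θ : ℝ, circleMap 0 r θ ≠ z := fun θ hθ => by
      rw [mem_ball_zero_iff, ← hθ] at hz
      simp at hz
    have hcomm : S (∮ z_1 in C(0, r), (z_1 - z)⁻¹ • g z_1)
        = ∮ z_1 in C(0, r), (z_1 - z)⁻¹ • S (g z_1) := by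
      simp only [circleIntegral]
      rw [← S.intervalIntegral_comp_comm]
      · simp
      · have h1 : CircleIntegrable (fun z_1 => (z_1 - z)⁻¹ • g z_1) 0 r := by
          rw [CircleIntegrable] at hint ⊢
          refine IntervalIntegrable.continuousOn_smul hint ?_
          refine ContinuousOn.inv₀ (by fun_prop) fun θ _ => sub_ne_zero.2 (hne θ)
        exact h1.out
    rw [hh]
    simp only
    rw [map_smul, hcomm, hci, inv_smul_smul₀ (by simp [Real.pi_ne_zero])]
  have hw' : w ∈ Metric.ball (0 : ℂ) r := by rwa [mem_ball_zero_iff]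
  have hdw : DifferentiableAt ℂ h w := by
    refine (hps.differentiableOn.differentiableAt ?_)
    refine (Metric.isOpen_eball).mem_nhds ?_
    simpa [Metric.mem_eball, edist_eq_enorm_sub, enorm_eq_nnnorm] using hw'
  refine (hdw.congr_of_eventuallyEq ?_).differentiableWithinAt
  filter_upwards [Metric.isOpen_ball.mem_nhds hw'] with z hz using hgh z hz

theorem norm_deriv_zero_le {g : ℂ → G} {R C : ℝ} (hR : 0 < R)
    (hg : DifferentiableOn ℂ g (Metric.ball 0 R))
    (hC : ∀ z ∈ Metric.ball (0 : ℂ) R, ‖g z‖ ≤ C) : ‖deriv g 0‖ ≤ 2 * C / R := by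
  refine Complex.norm_deriv_le_div_of_mapsTo_ball hg (fun z hz => ?_) hR
  rw [mem_closedBall_iff_norm, two_mul]
  exact (norm_sub_le _ _).trans (add_le_add (hC z hz) (hC 0 (Metric.mem_ball_self hR)))

/-- A quantitative first-order Taylor formula. -/
theorem norm_sub_sub_deriv_le {g : ℂ → G} {R C : ℝ} (hR : 1 < R)
    (hg : DifferentiableOn ℂ g (Metric.ball 0 R))
    (hC : ∀ z ∈ Metric.ball (0 : ℂ) R, ‖g z‖ ≤ C) :
    ‖g 1 - g 0 - deriv g 0‖ ≤ 4 * C / R ^ 2 := by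
  have hR0 : 0 < R := one_pos.trans hR
  have h0 : (0 : ℂ) ∈ Metric.ball (0 : ℂ) R := Metric.mem_ball_self hR0
  have hd := norm_deriv_zero_le hR0 hg hC
  have hder : HasDerivAt g (deriv g 0) 0 :=
    (hg.differentiableAt (Metric.isOpen_ball.mem_nhds h0)).hasDerivAt
  -- Higher-order Schwarz lemma: subtracting the linear term leaves an increment that is `o(z)` and
  -- bounded by `4C`, which gives the exponent 2.
  have key := Complex.dist_le_mul_div_pow_of_mapsTo_ball_of_isLittleO
    (f := fun z => g z - z • deriv g 0) (c := 0) (z := 1) (R₁ := R) (R₂ := 4 * C) (n := 1)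
    (hg.sub (by fun_prop)) (fun z hz => ?_) ?_ (by simpa using hR)
  · simp only [one_smul, zero_smul, sub_zero, dist_eq_norm, norm_one] at key
    rw [sub_right_comm]
    exact key.trans_eq (by ring)
  · rw [mem_closedBall_iff_norm]
    rw [mem_ball_zero_iff] at hz
    have h1 : ‖z‖ * ‖deriv g 0‖ ≤ 2 * C := by
      calc ‖z‖ * ‖deriv g 0‖ ≤ R * (2 * C / R) := by gcongr
        _ = 2 * C := by field_simp
    calc ‖g z - z • deriv g 0 - (g 0 - (0 : ℂ) • deriv g 0)‖
        = ‖g z - g 0 - z • deriv g 0‖ := by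
          congr 1
          simp only [zero_smul]
          abel
      _ ≤ ‖g z‖ + ‖g 0‖ + ‖z‖ * ‖deriv g 0‖ := by
          rw [← norm_smul]
          exact (norm_sub_le _ _).trans (by gcongr; exact norm_sub_le _ _)
      _ ≤ 4 * C := by
          have := hC z (mem_ball_zero_iff.2 hz)
          have := hC 0 h0
          linarith
  · have h1 := hder.isLittleO
    simp only [sub_zero] at h1
    simp only [pow_one, sub_zero, zero_smul]
    refine h1.norm_right.congr_left fun z => ?_
    abel

/-- A locally bounded mapping with values in a separable Banach space is holomorphic if its
composition with an injective operator is. -/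
theorem differentiableOn_of_injective_comp {E : Type*} [NormedAddCommGroup E] [NormedSpace ℂ E]
    [CompleteSpace G] [TopologicalSpace.SeparableSpace G] [CompleteSpace F] {U : Set E} (hU : IsOpen U)
    (S : G →L[ℂ] F) (hS : Function.Injective S) {g : E → G}
    (hb : ∀ x ∈ U, ∃ C, ∀ᶠ y in 𝓝 x, ‖g y‖ ≤ C)
    (hSg : DifferentiableOn ℂ (fun x => S (g x)) U) : DifferentiableOn ℂ g U := by
  intro x hx
  obtain ⟨C, hC⟩ := hb x hx
  obtain ⟨r, hr, hball⟩ := Metric.eventually_nhds_iff_ball.1 (hC.and (hU.eventually_mem hx))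
  have hCx : 0 ≤ C := (norm_nonneg _).trans (hball x (Metric.mem_ball_self hr)).1
  set D : E → G := fun h => deriv (fun ζ : ℂ => g (x + ζ • h)) 0 with hDdef
  have hmem : ∀ (h : E) (R : ℝ), R * ‖h‖ ≤ r → 0 < R → ∀ ζ ∈ Metric.ball (0 : ℂ) R,
      x + ζ • h ∈ Metric.ball x r := fun h R hRr hR ζ hζ => by
    rw [mem_ball_iff_norm, add_sub_cancel_left, norm_smul]
    rw [mem_ball_zero_iff] at hζ
    rcases (norm_nonneg h).eq_or_lt with h0 | h0
    · rw [← h0, mul_zero]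
      exact hr
    · exact (mul_lt_mul_of_pos_right hζ h0).trans_le hRr
  have hdiff : ∀ (h : E) (R : ℝ), R * ‖h‖ ≤ r → 0 < R →
      DifferentiableOn ℂ (fun ζ : ℂ => g (x + ζ • h)) (Metric.ball 0 R) := fun h R hRr hR => by
    refine differentiableOn_ball_of_injective_comp S hS (C := C)
      (fun ζ hζ => (hball _ (hmem h R hRr hR ζ hζ)).1) ?_
    refine hSg.comp (t := U) (f := fun ζ : ℂ => x + ζ • h) (by fun_prop) fun ζ hζ => ?_
    exact (hball _ (hmem h R hRr hR ζ hζ)).2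
  have hbd : ∀ (h : E) (R : ℝ), R * ‖h‖ ≤ r → 0 < R →
      ∀ ζ ∈ Metric.ball (0 : ℂ) R, ‖g (x + ζ • h)‖ ≤ C := fun h R hRr hR ζ hζ =>
    (hball _ (hmem h R hRr hR ζ hζ)).1
  have hrad : ∀ h : E, ∃ R : ℝ, 0 < R ∧ R * ‖h‖ ≤ r := fun h =>
    ⟨r / (‖h‖ + 1), by positivity, by
      rw [div_mul_eq_mul_div, div_le_iff₀ (by positivity)]
      nlinarith [norm_nonneg h]⟩
  -- `S` sends the directional derivative of `g` to the Fréchet derivative of `S ∘ g`, which is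
  -- linear; injectivity of `S` then makes `D` linear.
  have hSD : ∀ h, S (D h) = fderiv ℂ (fun x => S (g x)) x h := fun h => by
    obtain ⟨R, hR, hRr⟩ := hrad h
    have h1 : HasDerivAt (fun ζ : ℂ => g (x + ζ • h)) (D h) 0 :=
      ((hdiff h R hRr hR).differentiableAt (Metric.ball_mem_nhds _ hR)).hasDerivAt
    have h2 : HasDerivAt (fun ζ : ℂ => S (g (x + ζ • h))) (S (D h)) 0 :=
      S.hasFDerivAt.comp_hasDerivAt (0 : ℂ) h1
    have h3 : HasDerivAt (fun ζ : ℂ => x + ζ • h) h 0 := by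
      simpa using ((hasDerivAt_id (0 : ℂ)).smul_const h).const_add x
    have h4 : HasFDerivAt (fun x => S (g x)) (fderiv ℂ (fun x => S (g x)) x)
        (x + (0 : ℂ) • h) := by
      rw [zero_smul, add_zero]
      exact (hSg.differentiableAt (hU.mem_nhds hx)).hasFDerivAt
    have h5 : HasDerivAt (fun ζ : ℂ => S (g (x + ζ • h)))
        (fderiv ℂ (fun x => S (g x)) x h) 0 :=
      HasFDerivAt.comp_hasDerivAt (f := fun ζ : ℂ => x + ζ • h) (0 : ℂ) h4 h3
    exact h2.unique h5
  have hDle : ∀ h, ‖D h‖ ≤ 2 * C / r * ‖h‖ := fun h => by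
    rcases (norm_nonneg h).eq_or_lt with h0 | h0
    · have : h = 0 := norm_eq_zero.1 h0.symm
      simp [hDdef, this]
    · have hR : 0 < r / ‖h‖ := by positivity
      have hRr : r / ‖h‖ * ‖h‖ ≤ r := (div_mul_cancel₀ _ h0.ne').le
      refine (norm_deriv_zero_le hR (hdiff h _ hRr hR) (hbd h _ hRr hR)).trans_eq ?_
      field_simp
  let L : E →L[ℂ] G := LinearMap.mkContinuous
    { toFun := D
      map_add' := fun a b => hS (by simp [hSD])
      map_smul' := fun c a => hS (by simp [hSD]) } (2 * C / r) hDle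
  suffices h : HasFDerivAt g L x from h.differentiableAt.differentiableWithinAt
  rw [hasFDerivAt_iff_isLittleO_nhds_zero]
  have hO : (fun h => g (x + h) - g x - L h) =O[𝓝 0] fun h => ‖h‖ ^ 2 := by
    refine Asymptotics.IsBigO.of_bound (4 * C / r ^ 2) ?_
    filter_upwards [Metric.ball_mem_nhds (0 : E) hr] with h hh
    rw [mem_ball_zero_iff] at hh
    change ‖g (x + h) - g x - D h‖ ≤ _
    rcases (norm_nonneg h).eq_or_lt with h0 | h0
    · have : h = 0 := norm_eq_zero.1 h0.symm
      simp [hDdef, this]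
    -- `r / ‖h‖` is the radius of the disc of `ζ` with `x + ζ • h` in the ball; it turns the Taylor
    -- remainder into `4C/r² · ‖h‖²`.
    · have hR : 1 < r / ‖h‖ := by rwa [lt_div_iff₀ h0, one_mul]
      have hRr : r / ‖h‖ * ‖h‖ ≤ r := (div_mul_cancel₀ _ h0.ne').le
      have key := norm_sub_sub_deriv_le hR (hdiff h _ hRr (one_pos.trans hR))
        (hbd h _ hRr (one_pos.trans hR))
      simp only [one_smul, zero_smul, add_zero] at key
      refine key.trans_eq ?_
      rw [norm_pow, norm_norm]
      field_simp
  exact hO.trans_isLittleO (Asymptotics.isLittleO_norm_pow_id one_lt_two)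

end Holomorphy

/-! ### Images of compact sets under ideal operators -/

namespace CompactKind

variable {X Y : Type*} [NormedAddCommGroup X] [NormedSpace ℂ X]
  [NormedAddCommGroup Y] [NormedSpace ℂ Y] {p : ℝ} {I J : CompactKind}

theorem size_le {K : Set X} {x : ℕ → X} (hx : x ∈ I.seqSpace p) (hK : K ⊆ pConv p x) :
    I.size p K ≤ I.norm p x :=
  iInf₂_le_of_le x hx (iInf_le _ hK)

theorem exists_norm_lt_of_size_lt {K : Set X} {c : ℝ≥0∞} (h : I.size p K < c) :
    ∃ x ∈ I.seqSpace p, K ⊆ pConv p x ∧ I.norm p x < c := by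
  simp only [size, iInf_lt_iff] at h
  obtain ⟨x, hx, hK, h⟩ := h
  exact ⟨x, hx, hK, h⟩

theorem size_ne_top_of_relCompact {K : Set X} (hK : I.RelCompact p K) : I.size p K ≠ ∞ := by
  obtain ⟨x, hx, hK⟩ := hK
  exact ((size_le hx hK).trans_lt (norm_lt_top hx)).ne

/-- The image of a bounded set under an operator of the ideal. -/
theorem image_subset_pConv (hp : 1 ≤ p) {T : Y →L[ℂ] X} {K : Set Y} {y : ℕ → Y}
    (hy : y ∈ J.seqSpace p) (hK : K ⊆ pConv p y) {x : ℕ → X}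
    (hT : T '' Metric.closedBall 0 1 ⊆ pConv p x) :
    T '' K ⊆ pConv p (fun n => ((J.norm p y).toReal : ℂ) • x n) := by
  rintro _ ⟨k, hk, rfl⟩
  set c := (J.norm p y).toReal with hc
  have hw := weakSeqNorm_le_norm (I := J) (one_pos.trans_le hp) y
  have hkc : ‖k‖ ≤ c :=
    (norm_le_of_mem_pConv hp (hw.trans_lt (norm_lt_top hy)) (hK hk)).trans
      (ENNReal.toReal_mono (norm_lt_top hy).ne hw)
  -- If `c = 0`, then `k = 0` and the convention `0⁻¹ = 0` is harmless.
  have hk' : k = (c : ℂ) • ((c : ℂ)⁻¹ • k) := by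
    rcases eq_or_ne c 0 with h0 | h0
    · rw [h0] at hkc ⊢
      simpa using hkc
    · rw [smul_inv_smul₀ (by exact_mod_cast h0)]
  rw [hk', map_smul]
  refine smul_mem_pConv _ (hT ⟨_, ?_, rfl⟩)
  rw [mem_closedBall_zero_iff, norm_smul, norm_inv, Complex.norm_real,
    Real.norm_of_nonneg ENNReal.toReal_nonneg]
  exact inv_mul_le_one_of_le₀ hkc ENNReal.toReal_nonneg

theorem relCompact_image (hp : 1 ≤ p) {T : Y →L[ℂ] X} {K : Set Y}
    (hK : J.RelCompact p K) (hT : I.MemIdeal p T) : I.RelCompact p (T '' K) := by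
  obtain ⟨y, hy, hK⟩ := hK
  obtain ⟨x, hx, hT⟩ := hT
  exact ⟨_, const_smul_mem_seqSpace (one_pos.trans_le hp) _ hx, image_subset_pConv hp hy hK hT⟩

/-- Near-optimal sequences for `T` and `K` multiply; finiteness of both sizes rules out the product
`0 · ∞` when passing to the infima. -/
theorem size_image_le (hp : 1 ≤ p) {T : Y →L[ℂ] X} {K : Set Y}
    (hK : J.RelCompact p K) (hT : I.MemIdeal p T) :
    I.size p (T '' K) ≤ I.idealNorm p T * J.size p K := by
  refine ENNReal.le_mul_of_forall_lt (Or.inr (size_ne_top_of_relCompact hK))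
    (Or.inl (size_ne_top_of_relCompact hT)) fun a ha b hb => ?_
  obtain ⟨x, hx, hxT, hxa⟩ := exists_norm_lt_of_size_lt ha
  obtain ⟨y, hy, hyK, hyb⟩ := exists_norm_lt_of_size_lt hb
  have hp0 : 0 < p := one_pos.trans_le hp
  refine (size_le (const_smul_mem_seqSpace hp0 _ hx) (image_subset_pConv hp hy hyK hxT)).trans ?_
  refine (norm_const_smul_le hp0 _ x).trans ?_
  rw [← ofReal_norm, Complex.norm_real, Real.norm_of_nonneg ENNReal.toReal_nonneg,
    ENNReal.ofReal_toReal (norm_lt_top hy).ne, mul_comm]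
  exact mul_le_mul' hxa.le hyb.le

end CompactKind

/-! ### The factorization and its norm -/

section Factorization

variable {E F : Type*} [NormedAddCommGroup E] [NormedSpace ℂ E]
  [NormedAddCommGroup F] [NormedSpace ℂ F] {U : Set E} {v : E → ℝ} {p : ℝ} {I : CompactKind}

theorem IsFactorization.vRange_eq {G : Type*} [NormedAddCommGroup G] [NormedSpace ℂ G]
    {f : E → F} {S : G →L[ℂ] F} {g : E → G} (h : IsFactorization I p U v f S g) :
    vRange U v f = S '' vRange U v g := by
  rw [vRange, vRange, image_image]
  exact image_congr fun x hx => by rw [h.2.2 x hx, map_smul]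

theorem IsFactorization.relCompact_vRange (hp : 1 ≤ p) {G : Type*} [NormedAddCommGroup G]
    [NormedSpace ℂ G] {f : E → F} {S : G →L[ℂ] F} {g : E → G}
    (h : IsFactorization I p U v f S g) : I.RelCompact p (vRange U v f) := by
  rw [h.vRange_eq]
  exact CompactKind.relCompact_image hp h.2.1.2 h.1

theorem IsFactorization.weightedHolIdealNorm_le (hp : 1 ≤ p) {G : Type*} [NormedAddCommGroup G]
    [NormedSpace ℂ G] {f : E → F} {S : G →L[ℂ] F} {g : E → G}
    (h : IsFactorization I p U v f S g) :
    weightedHolIdealNorm I p U v f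
      ≤ I.idealNorm p S * weightedHolIdealNorm I.inner p U v g := by
  rw [weightedHolIdealNorm, h.vRange_eq]
  exact CompactKind.size_image_le hp h.2.1.2 h.1

/-- A mapping whose `v`-range lies in the `p`-convex hull of `x` factors through a quotient of
the coefficient space, with almost the norm of `x`. -/
theorem exists_isFactorization [CompleteSpace F] (hU : IsOpen U) (hv : IsWeight U v)
    (hp : 1 ≤ p) {f : E → F} (hf : f ∈ weightedHol U v) {x : ℕ → F} (hx : x ∈ I.seqSpace p)
    (hfx : vRange U v f ⊆ pConv p x) {ε : ℝ} (hε : 0 < ε) :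
    ∃ (M : Submodule ℂ (CoeffSpace p)) (_ : IsClosed (M : Set (CoeffSpace p)))
      (S : (CoeffSpace p ⧸ M) →L[ℂ] F) (g : E → CoeffSpace p ⧸ M),
      IsFactorization I p U v f S g ∧
      I.idealNorm p S * weightedHolIdealNorm I.inner p U v g
        ≤ ENNReal.ofReal (1 + ε) * (I.norm p x + ENNReal.ofReal ε) := by
  have hp0 : 0 < p := one_pos.trans_le hp
  obtain ⟨lam, y, hy, hyx, hxy, hlam, hlam0⟩ :=
    CompactKind.exists_smul_factorization hp hx (ENNReal.ofReal_pos.2 hε).ne'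
      ENNReal.ofReal_lt_top
  have hyw : weakSeqNorm p y < ∞ :=
    (CompactKind.weakSeqNorm_le_norm (I := I) hp0 y).trans_lt (CompactKind.norm_lt_top hy)
  set θ := synthesis hp hyw with hθ
  have hew : weakSeqNorm p (fun n => lam n • CoeffSpace.single p n 1) < ∞ := by
    refine ((weakSeqNorm_smul_le hp0 hlam _).trans ?_).trans_lt ENNReal.one_lt_top
    rw [one_mul]
    exact weakSeqNorm_single_le hp
  -- `Λ` is the diagonal operator `(a_n) ↦ (λ_n a_n)`.
  set Λ := synthesis hp hew with hΛ
  have hM : IsClosed (θ.ker : Set (CoeffSpace p)) := θ.isClosed_ker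
  have : TopologicalSpace.SeparableSpace (CoeffSpace p) := CoeffSpace.separableSpace hp
  set q : CoeffSpace p →L[ℂ] CoeffSpace p ⧸ θ.ker := θ.ker.mkQL with hq
  have hqsurj : Function.Surjective q := Submodule.Quotient.mk_surjective _
  have : TopologicalSpace.SeparableSpace (CoeffSpace p ⧸ θ.ker) :=
    hqsurj.denseRange.separableSpace q.continuous
  have hqle : ∀ a, ‖q a‖ ≤ ‖a‖ := fun a => Submodule.Quotient.norm_mk_le _ a
  have hqnorm : ‖q‖ ≤ 1 := q.opNorm_le_bound zero_le_one fun a => by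
    rw [one_mul]
    exact hqle a
  set S : (CoeffSpace p ⧸ θ.ker) →L[ℂ] F := θ.ker.liftQL θ le_rfl with hS
  have hSq : ∀ a, S (q a) = θ a := fun a => rfl
  have hSinj : Function.Injective S := by
    refine (injective_iff_map_eq_zero S).2 fun z hz => ?_
    obtain ⟨a, rfl⟩ := hqsurj z
    exact (Submodule.Quotient.mk_eq_zero _).2 hz
  have hex : ∀ u : E, ∃ a : CoeffSpace p, ‖a‖ ≤ 1 ∧
      (u ∈ U → HasSum (fun n => a.coord n • x n) ((v u : ℂ) • f u)) := fun u => by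
    by_cases hu : u ∈ U
    · obtain ⟨a, ha, has⟩ := hfx ⟨u, hu, rfl⟩
      exact ⟨a, ha, fun _ => has⟩
    · exact ⟨0, by simp, fun h => absurd h hu⟩
  choose a ha1 hasum using hex
  have hθΛ : ∀ u ∈ U, θ (Λ (a u)) = (v u : ℂ) • f u := fun u hu => by
    refine HasSum.unique ?_ (hasum u hu)
    convert! (hasSum_synthesis hp hew (a u)).mapL θ using 2 with n
    rw [map_smul, map_smul, hθ, synthesis_single, hxy]
  have hvC : ∀ u ∈ U, (v u : ℂ) ≠ 0 := fun u hu => by exact_mod_cast (hv.2 u hu).ne'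
  set g : E → CoeffSpace p ⧸ θ.ker := fun u => (v u : ℂ)⁻¹ • q (Λ (a u)) with hg
  have hSg : ∀ u ∈ U, f u = S (g u) := fun u hu => by
    rw [hg, map_smul, hSq, hθΛ u hu, inv_smul_smul₀ (hvC u hu)]
  have hvg : ∀ u ∈ U, (v u : ℂ) • g u = q (Λ (a u)) := fun u hu => smul_inv_smul₀ (hvC u hu) _
  have hrange : vRange U v g ⊆ pConv p (fun n => lam n • q (CoeffSpace.single p n 1)) := by
    rintro _ ⟨u, hu, rfl⟩
    refine ⟨a u, ha1 u, ?_⟩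
    simp only [hvg u hu]
    simpa only [map_smul] using (hasSum_synthesis hp hew (a u)).mapL q
  have hqe : weakSeqNorm p (fun n => q (CoeffSpace.single p n 1)) ≤ 1 :=
    (weakSeqNorm_comp_le _ hqnorm).trans (weakSeqNorm_single_le hp)
  obtain ⟨hmem, hnorm⟩ := CompactKind.smul_mem_seqSpace_inner hp hlam hlam0 hqe
  have hbound : ∀ u ∈ U, v u * ‖g u‖ ≤ 1 := fun u hu => by
    have h1 : q (Λ (a u)) ∈ pConv p (fun n => lam n • q (CoeffSpace.single p n 1)) :=
      hrange ⟨u, hu, hvg u hu⟩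
    have hw : weakSeqNorm p (fun n => lam n • q (CoeffSpace.single p n 1)) ≤ 1 :=
      (CompactKind.weakSeqNorm_le_norm (I := I.inner) hp0 _).trans hnorm
    have h2 := (norm_le_of_mem_pConv hp (hw.trans_lt ENNReal.one_lt_top) h1).trans
      (ENNReal.toReal_mono ENNReal.one_ne_top hw)
    rw [← hvg u hu, norm_smul, Complex.norm_real, Real.norm_of_nonneg (hv.2 u hu).le] at h2
    simpa using h2
  have hdiff : DifferentiableOn ℂ g U := by
    -- Near `u` the weight exceeds `v u / 2`, so `v ‖g‖ ≤ 1` gives the local bound `2 / v u`.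
    refine differentiableOn_of_injective_comp hU S hSinj (fun u hu => ⟨2 / v u, ?_⟩)
      (hf.1.congr fun u hu => (hSg u hu).symm)
    have hvu := hv.2 u hu
    have hcont := hv.1.continuousAt (hU.mem_nhds hu)
    filter_upwards [hU.mem_nhds hu, hcont.eventually (lt_mem_nhds (half_lt_self hvu))]
      with w hw hvw
    rw [le_div_iff₀ hvu]
    have := hbound w hw
    nlinarith [norm_nonneg (g w)]
  have hball : S '' Metric.closedBall 0 1 ⊆ pConv p (fun n => ((1 + ε : ℝ) : ℂ) • y n) := by
    rintro _ ⟨z, hz, rfl⟩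
    -- A class in the closed unit ball need not have a representative of norm at most 1; allowing `1
    -- + ε` is the source of that factor in the norm estimate.
    obtain ⟨b, rfl, hb⟩ := Submodule.Quotient.norm_mk_lt z hε
    rw [mem_closedBall_zero_iff] at hz
    exact synthesis_mem_pConv hp hyw (by positivity) (hb.le.trans (by gcongr))
  have hyε := CompactKind.const_smul_mem_seqSpace hp0 ((1 + ε : ℝ) : ℂ) hy
  refine ⟨θ.ker, hM, S, g, ⟨⟨_, hyε, hball⟩, ⟨⟨hdiff, 1, ?_⟩, _, hmem, hrange⟩, hSg⟩, ?_⟩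
  · rintro _ ⟨u, hu, rfl⟩
    exact hbound u hu
  · rw [← mul_one (ENNReal.ofReal (1 + ε) * _)]
    refine mul_le_mul' ?_ ((CompactKind.size_le hmem hrange).trans hnorm)
    refine (CompactKind.size_le hyε hball).trans ((CompactKind.norm_const_smul_le hp0 _ y).trans ?_)
    rw [← ofReal_norm, Complex.norm_real, Real.norm_of_nonneg (by positivity)]
    exact mul_le_mul_right hyx _

end Factorization

theorem mainTheorem5 {E F : Type*}
    [NormedAddCommGroup E] [NormedSpace ℂ E] [CompleteSpace E]
    [NormedAddCommGroup F] [NormedSpace ℂ F] [CompleteSpace F]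
    (U : Set E) (hU : IsOpen U) (v : E → ℝ) (hv : IsWeight U v)
    (p : ℝ) (hp : 1 ≤ p) (I : CompactKind)
    (f : E → F) (hf : f ∈ weightedHol U v) :
    (f ∈ weightedHolIdeal I p U v ↔
      ∃ (M : Submodule ℂ (CoeffSpace p)) (_ : IsClosed (M : Set (CoeffSpace p)))
        (S : (CoeffSpace p ⧸ M) →L[ℂ] F) (g : E → CoeffSpace p ⧸ M),
        IsFactorization I p U v f S g) ∧
    (f ∈ weightedHolIdeal I p U v →
      IsGLB {c : ℝ≥0∞ |
        ∃ (M : Submodule ℂ (CoeffSpace p)) (_ : IsClosed (M : Set (CoeffSpace p)))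
          (S : (CoeffSpace p ⧸ M) →L[ℂ] F) (g : E → CoeffSpace p ⧸ M),
          IsFactorization I p U v f S g ∧
          c = I.idealNorm p S * weightedHolIdealNorm I.inner p U v g}
        (weightedHolIdealNorm I p U v f)) := by
  refine ⟨⟨fun h => ?_, ?_⟩, fun _ => ⟨?_, fun b hb => ?_⟩⟩
  · obtain ⟨x, hx, hfx⟩ := h.2
    obtain ⟨M, hM, S, g, hfac, -⟩ := exists_isFactorization hU hv hp hf hx hfx one_pos
    exact ⟨M, hM, S, g, hfac⟩
  · rintro ⟨M, hM, S, g, hfac⟩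
    exact ⟨hf, hfac.relCompact_vRange hp⟩
  · rintro _ ⟨M, hM, S, g, hfac, rfl⟩
    exact hfac.weightedHolIdealNorm_le hp
  · refine le_iInf₂ fun x hx => le_iInf fun hfx => ?_
    -- The quotient, `S` and `g` vary with `ε`, but the lower bound `b` does not, so `ε → 0` yields
    -- `b ≤ I.norm p x`.
    have hle : ∀ ε : ℝ, 0 < ε →
        b ≤ ENNReal.ofReal (1 + ε) * (I.norm p x + ENNReal.ofReal ε) := fun ε hε => by
      obtain ⟨M, hM, S, g, hfac, hn⟩ := exists_isFactorization hU hv hp hf hx hfx hε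
      exact (hb ⟨M, hM, S, g, hfac, rfl⟩).trans hn
    have h0 : Tendsto (fun ε : ℝ => ε) (𝓝[>] 0) (𝓝 0) := nhdsWithin_le_nhds
    have h1 : Tendsto (fun ε : ℝ => ENNReal.ofReal (1 + ε)) (𝓝[>] 0) (𝓝 1) := by
      simpa using ENNReal.tendsto_ofReal (h0.const_add 1)
    have h2 : Tendsto (fun ε : ℝ => I.norm p x + ENNReal.ofReal ε) (𝓝[>] 0)
        (𝓝 (I.norm p x)) := by
      simpa using (ENNReal.tendsto_ofReal h0).const_add (I.norm p x)
    have h3 := ENNReal.Tendsto.mul h1 (Or.inl one_ne_zero) h2 (Or.inr ENNReal.one_ne_top)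
    rw [one_mul] at h3
    exact ge_of_tendsto h3 (eventually_nhdsWithin_of_forall hle)
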